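/- Let $\mathfrak{P}_r$ be a representation system of the isomorphism classes of non-empty finite posets, and let $\mathcal{H}(P,R)$ denote the set of order homomorphisms (order-preserving maps) $P\to R$. Notation: For a poset $P$ and $A\subseteq P$ put ${\downarrow^\circ}A=\{y\in P: \exists a\in A,\ y\le a\}\setminus A$ and ${\uparrow_\circ}A=\{y\in P:\exists a\in A,\ a\le y\}\setminus A$. For $\xi\in\mathcal{H}(P,R)$ and $x\in P$ let $G_\xi(x)$ be the set of all $y$ in the fibre $\xi^{-1}(\xi(x))$ that can be joined to $x$ by a finite sequence $x=z_0,\dots,z_L=y$ ($L\ge 0$) in this fibre such that $z_{\ell-1}<z_\ell$ or $z_{\ell-1}>z_\ell$ for all $1\le\ell\le L$. Let $$\mathcal{E}(R)=\{(x,D,U): x\in R,\ D\subseteq{\downarrow^\circ}\{x\},\ U\subseteq{\uparrow_\circ}\{x\}\},$$ define $\mathfrak{a}<_+\mathfrak{b}$ on $\mathcal{E}(R)$ by $\mathfrak{a}_1\in\mathfrak{b}_2$ and $\mathfrak{b}_1\in\mathfrak{a}_3$, let $\mathfrak{a}\le_+\mathfrak{b}$ mean $\mathfrak{a}<_+\mathfrak{b}$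 or $\mathfrak{a}=\mathfrak{b}$, and put $$\alpha_{P,\xi}(x)=\bigl(\xi(x),\ \xi({\downarrow^\circ}G_\xi(x)),\ \xi({\uparrow_\circ}G_\xi(x))\bigr)\in\mathcal{E}(R).$$ A strong I-scheme from $R$ to $S$ is a family of one-to-one maps $\rho_P:\mathcal{H}(P,R)\to\mathcal{H}(P,S)$, $P\in\mathfrak{P}_r$, such that for all $P,P'\in\mathfrak{P}_r$, $\xi\in\mathcal{H}(P,R)$, $\zeta\in\mathcal{H}(P',R)$, $x\in P$, $y\in P'$: if $\alpha_{P,\xi}(x)\le_+\alpha_{P',\zeta}(y)$, then $\alpha_{P,\rho_P(\xi)}(x)\le_+\alpha_{P',\rho_{P'}(\zeta)}(y)$, and if $\alpha_{P,\xi}(x)<_+\alpha_{P',\zeta}(y)$, then $\alpha_{P,\rho_P(\xi)}(x)<_+\alpha_{P',\rho_{P'}(\zeta)}(y)$. Write $R\sqsubseteq_I S$ if a strong I-scheme from $R$ to $S$ exists. **Theorem.** Let $Q,R,S$ be non-empty finite posets such that $Q$ is disjoint from $R$ and from $S$, and let $Q+R$, $Q+S$ denote the direct sums (disjoint unions, without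 comparabilities between the summands). Then $$Q+R\sqsubseteq_I Q+S\quad\Rightarrow\quad R\sqsubseteq_I S.$$ -/

import Mathlib

namespace HomSchemes

universe u v w

/-- The class of all non-empty finite posets. -/
structure FinPoset : Type (w + 1) where
  /-- the carrier of the poset -/
  carrier : Type w
  [order : PartialOrder carrier]
  [finite : Finite carrier]
  [nonempty : Nonempty carrier]

instance : CoeSort FinPoset.{w} (Type w) := ⟨FinPoset.carrier⟩

attribute [instance] FinPoset.order FinPoset.finite FinPoset.nonempty

/-- `𝔓r` is a representation system of the non-isomorphic non-empty finite posets: every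
non-empty finite poset is isomorphic to exactly one member of `𝔓r`. -/
def IsRepSystem (𝔓r : Set FinPoset.{w}) : Prop :=
  ∀ P : FinPoset.{w}, ∃! P' : FinPoset.{w}, P' ∈ 𝔓r ∧ Nonempty (P ≃o P')

section Basic

variable {P : Type u} [PartialOrder P] {R : Type v} [PartialOrder R]

/-- `(↓ A) \ A` -/
def openDown (A : Set P) : Set P := {y | ∃ a ∈ A, y ≤ a} \ A

/-- `(↑ A) \ A` -/
def openUp (A : Set P) : Set P := {y | ∃ a ∈ A, a ≤ y} \ A

/-- `γ_A(x)`: the points of `A` that are joined to `x` by a zigzag line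
`x = z₀, z₁, …, z_L = y` in `A` in which consecutive points are strictly comparable. -/
def gamma (A : Set P) (x : P) : Set P :=
  {y | y ∈ A ∧ Relation.ReflTransGen (fun a b => a ∈ A ∧ b ∈ A ∧ (a < b ∨ b < a)) x y}

/-- `G_ξ(x)`: the connectivity component of `x` in the fibre `ξ⁻¹(ξ(x))`. -/
def gxi {Y : Type v} (ξ : P → Y) (x : P) : Set P := gamma (ξ ⁻¹' {ξ x}) x

/-- The EV-system of a poset: the triples `(x, D, U)` with `x ∈ P`,
`D ⊆ (↓ x) \ {x}` and `U ⊆ (↑ x) \ {x}`. -/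
@[ext]
structure EV (P : Type u) [PartialOrder P] where
  /-- first component -/
  pt : P
  /-- second component -/
  dn : Set P
  /-- third component -/
  up : Set P
  dn_subset : dn ⊆ openDown {pt}
  up_subset : up ⊆ openUp {pt}

/-- The relation `<₊` on the EV-system. -/
def EV.LtPlus (a b : EV P) : Prop := a.pt ∈ b.dn ∧ b.pt ∈ a.up

/-- The relation `≤₊` on the EV-system. -/
def EV.LePlus (a b : EV P) : Prop := EV.LtPlus a b ∨ a = b

theorem image_openDown_gxi_subset (ξ : P →o R) (x : P) :
    ξ '' openDown (gxi ξ x) ⊆ openDown {ξ x} := by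
  rintro _ ⟨y, ⟨⟨a, ha, hya⟩, hy⟩, rfl⟩
  have hax : ξ a = ξ x := ha.1
  refine ⟨⟨ξ x, rfl, hax ▸ ξ.monotone hya⟩, fun h => hy ?_⟩
  have hyx : ξ y = ξ x := h
  have hne : y ≠ a := fun e => hy (e ▸ ha)
  exact ⟨hyx, ha.2.tail ⟨hax, hyx, Or.inr (lt_of_le_of_ne hya hne)⟩⟩

theorem image_openUp_gxi_subset (ξ : P →o R) (x : P) :
    ξ '' openUp (gxi ξ x) ⊆ openUp {ξ x} := by
  rintro _ ⟨y, ⟨⟨a, ha, hay⟩, hy⟩, rfl⟩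
  have hax : ξ a = ξ x := ha.1
  refine ⟨⟨ξ x, rfl, hax ▸ ξ.monotone hay⟩, fun h => hy ?_⟩
  have hyx : ξ y = ξ x := h
  have hne : a ≠ y := fun e => hy (e ▸ ha)
  exact ⟨hyx, ha.2.tail ⟨hax, hyx, Or.inl (lt_of_le_of_ne hay hne)⟩⟩

/-- `α_{P,ξ}(x) = (ξ(x), ξ((↓ G_ξ(x)) \ G_ξ(x)), ξ((↑ G_ξ(x)) \ G_ξ(x)))`, for an
order homomorphism `ξ : P → R`. -/
def alpha (ξ : P →o R) (x : P) : EV R where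
  pt := ξ x
  dn := ξ '' openDown (gxi ξ x)
  up := ξ '' openUp (gxi ξ x)
  dn_subset := image_openDown_gxi_subset ξ x
  up_subset := image_openUp_gxi_subset ξ x

end Basic

section Scheme

variable (𝔓r : Set FinPoset.{w}) (R : Type u) [PartialOrder R] (S : Type v) [PartialOrder S]

/-- Hom-schemes from `R` to `S`: families of mappings `ρ_P : H(P,R) → H(P,S)`, `P ∈ 𝔓r`. -/
def HomScheme := ∀ P : FinPoset.{w}, P ∈ 𝔓r → (P →o R) → (P →o S)

variable {𝔓r R S}

/-- A Hom-scheme is strong iff every `ρ_P` is one-to-one. -/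
def HomScheme.IsStrong (ρ : HomScheme 𝔓r R S) : Prop :=
  ∀ (P : FinPoset.{w}) (hP : P ∈ 𝔓r), Function.Injective (ρ P hP)

/-- A Hom-scheme is an I-scheme (image-controlled) iff `α_{P,ξ}(x) ≤₊ α_{P',ζ}(y)` implies
`α_{P,ρ(ξ)}(x) ≤₊ α_{P',ρ(ζ)}(y)`, where `<₊` on the left side implies `<₊` on the right side. -/
def HomScheme.IsIScheme (ρ : HomScheme 𝔓r R S) : Prop :=
  ∀ (P : FinPoset.{w}) (hP : P ∈ 𝔓r) (P' : FinPoset.{w}) (hP' : P' ∈ 𝔓r)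
    (ξ : P →o R) (ζ : P' →o R) (x : P) (y : P'),
    ((alpha ξ x).LePlus (alpha ζ y) →
      (alpha (ρ P hP ξ) x).LePlus (alpha (ρ P' hP' ζ) y)) ∧
    ((alpha ξ x).LtPlus (alpha ζ y) →
      (alpha (ρ P hP ξ) x).LtPlus (alpha (ρ P' hP' ζ) y))

variable (𝔓r R S)

/-- `R ⊑_I S`: there exists a strong I-scheme from `R` to `S`. -/
def StrongILe : Prop := ∃ ρ : HomScheme 𝔓r R S, ρ.IsStrong ∧ ρ.IsIScheme

end Scheme

end HomSchemes

/-! The relation `R ⊑_I S` is equivalent to two elementary conditions: there is a strictly monotone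
map `R → S` that is injective on edges, i.e. on pairs `x < y` (`EdgeInjective`; it may identify
points), and there is some injective map `R → S` of sets.

Given such `f` and `h`, apply `h` on fibre components that are whole components of `P`, and `f`
elsewhere (`strongILe_of_edgeInjective`). Conversely, the one-point poset yields `h`
(`exists_injective`), and homomorphisms from the two-element chain, compared by means of a
four-element fence, yield `f` (`exists_strictMono_edgeInjective`).

Both conditions survive cancelling `Q`. The injection does so by cardinality. For the edge map,
follow an edge of `R` under `f`, reapplying `f` while it lies in `Q`. By finiteness of `Q` and edge
injectivity it ends up in `S`, and distinct edges end up at distinct edges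
(`exists_strictMono_edgeInjective_of_sum`). -/

namespace HomSchemes

universe u v w

/-! ### Fibre components and the invariant `alpha`. -/

section Alpha

variable {P : Type u} [PartialOrder P] {R : Type v} [PartialOrder R]

theorem self_mem_gxi {Y : Type*} (ξ : P → Y) (x : P) : x ∈ gxi ξ x := ⟨rfl, .refl⟩

theorem gxi_eq_of_comparable {Y : Type*} {ξ : P → Y} {x y : P} (h : x < y ∨ y < x) (hξ : ξ x = ξ y) :
    gxi ξ x = gxi ξ y := by
  have hx : x ∈ ξ ⁻¹' {ξ y} := hξ
  have hy : y ∈ ξ ⁻¹' {ξ y} := rfl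
  unfold gxi gamma
  rw [hξ]
  ext z
  exact ⟨fun hz => ⟨hz.1, .head ⟨hy, hx, h.symm⟩ hz.2⟩,
    fun hz => ⟨hz.1, .head ⟨hx, hy, h⟩ hz.2⟩⟩

theorem alpha_eq_of_comparable {ξ : P →o R} {x y : P} (h : x < y ∨ y < x) (hξ : ξ x = ξ y) :
    alpha ξ x = alpha ξ y := by
  have hG := gxi_eq_of_comparable h hξ
  apply EV.ext
  · exact hξ
  · simp only [alpha, hG]
  · simp only [alpha, hG]

/-- The connectivity components of fibres depend only on which comparable points are
identified. -/
theorem gxi_subset_of_comparable {Y Z : Type*} {ξ : P → Y} {η : P → Z}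
    (h : ∀ a b, a < b → ξ a = ξ b → η a = η b) (x : P) : gxi ξ x ⊆ gxi η x := by
  rintro y ⟨-, hy⟩
  induction hy with
  | refl => exact self_mem_gxi η x
  | @tail b c _ hbc ih =>
    obtain ⟨hb, hc, hlt⟩ := hbc
    have hξ : ξ b = ξ c := hb.trans hc.symm
    have hη : η b = η c := hlt.elim (fun l => h _ _ l hξ) (fun l => (h _ _ l hξ.symm).symm)
    have hcx : η c = η x := hη.symm.trans ih.1
    exact ⟨hcx, ih.2.tail ⟨ih.1, hcx, hlt⟩⟩

theorem mem_openDown_gxi {Y : Type*} {ξ : P → Y} {p q : P} (h : p < q) (hξ : ξ p ≠ ξ q) :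
    p ∈ openDown (gxi ξ q) :=
  ⟨⟨q, self_mem_gxi ξ q, h.le⟩, fun hp => hξ hp.1⟩

theorem mem_openUp_gxi {Y : Type*} {ξ : P → Y} {p q : P} (h : p < q) (hξ : ξ p ≠ ξ q) :
    q ∈ openUp (gxi ξ p) :=
  ⟨⟨p, self_mem_gxi ξ p, h.le⟩, fun hp => hξ hp.1.symm⟩

theorem exists_of_mem_openDown_gxi {ξ : P →o R} {x y : P} (hy : y ∈ openDown (gxi ξ x)) :
    ∃ a ∈ gxi ξ x, y < a ∧ ξ y < ξ a := by
  obtain ⟨⟨a, ha, hya⟩, hn⟩ := hy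
  have hlt : y < a := lt_of_le_of_ne hya fun e => hn (e ▸ ha)
  refine ⟨a, ha, hlt, lt_of_le_of_ne (ξ.monotone hya) fun e => hn ?_⟩
  have hyx : ξ y = ξ x := e.trans ha.1
  exact ⟨hyx, ha.2.tail ⟨ha.1, hyx, Or.inr hlt⟩⟩

theorem exists_of_mem_openUp_gxi {ξ : P →o R} {x y : P} (hy : y ∈ openUp (gxi ξ x)) :
    ∃ a ∈ gxi ξ x, a < y ∧ ξ a < ξ y := by
  obtain ⟨⟨a, ha, hya⟩, hn⟩ := hy
  have hlt : a < y := lt_of_le_of_ne hya fun e => hn (e ▸ ha)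
  refine ⟨a, ha, hlt, lt_of_le_of_ne (ξ.monotone hya) fun e => hn ?_⟩
  have hyx : ξ y = ξ x := e.symm.trans ha.1
  exact ⟨hyx, ha.2.tail ⟨ha.1, hyx, Or.inl hlt⟩⟩

theorem alpha_ltPlus {ξ : P →o R} {p q : P} (h : p < q) (hξ : ξ p ≠ ξ q) :
    (alpha ξ p).LtPlus (alpha ξ q) :=
  ⟨⟨p, mem_openDown_gxi h hξ, rfl⟩, ⟨q, mem_openUp_gxi h hξ, rfl⟩⟩

theorem EV.LtPlus.pt_lt {a b : EV R} (h : a.LtPlus b) : a.pt < b.pt := by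
  obtain ⟨⟨c, hc, hle⟩, hn⟩ := b.dn_subset h.1
  obtain rfl : c = b.pt := hc
  exact lt_of_le_of_ne hle hn

theorem EV.LePlus.antisymm {a b : EV R} (h : a.LePlus b) (h' : b.LePlus a) : a = b := by
  rcases h with h | h
  · rcases h' with h' | h'
    · exact absurd (h.pt_lt.trans h'.pt_lt) (lt_irrefl _)
    · exact h'.symm
  · exact h

theorem gxi_eq_singleton {Y : Type*} {ξ : P → Y} {x : P} (hd : ∀ y, y < x → ξ y ≠ ξ x)
    (hu : ∀ y, x < y → ξ y ≠ ξ x) : gxi ξ x = {x} := by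
  apply Set.Subset.antisymm _ (Set.singleton_subset_iff.2 (self_mem_gxi ξ x))
  rintro y ⟨-, hy⟩
  induction hy with
  | refl => rfl
  | @tail b c _ hbc ih =>
    obtain rfl : b = x := ih
    obtain ⟨-, hc, h | h⟩ := hbc
    · exact absurd hc (hu _ h)
    · exact absurd hc (hd _ h)

theorem openDown_singleton (x : P) : openDown {x} = Set.Iio x := by
  ext y
  simp [openDown, lt_iff_le_and_ne]

theorem openUp_singleton (x : P) : openUp {x} = Set.Ioi x := by
  ext y
  simp [openUp, lt_iff_le_and_ne, eq_comm]

theorem alpha_eq_iff_of_strict_at {ξ : P →o R} {x : P} (hd : ∀ y, y < x → ξ y ≠ ξ x)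
    (hu : ∀ y, x < y → ξ y ≠ ξ x) (a : EV R) :
    alpha ξ x = a ↔ ξ x = a.pt ∧ ξ '' Set.Iio x = a.dn ∧ ξ '' Set.Ioi x = a.up := by
  rw [EV.ext_iff]
  simp only [alpha, gxi_eq_singleton hd hu, openDown_singleton, openUp_singleton]

theorem gxi_comp_orderIso {P' : Type*} [PartialOrder P'] {Y : Type*} (e : P' ≃o P) (ξ : P → Y) (x : P') :
    gxi (ξ ∘ e) x = e ⁻¹' gxi ξ (e x) := by
  ext y
  constructor
  · rintro ⟨hy, h⟩
    exact ⟨hy, h.lift e fun a b hab =>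
      ⟨hab.1, hab.2.1, hab.2.2.imp e.lt_iff_lt.2 e.lt_iff_lt.2⟩⟩
  · rintro ⟨hy, h⟩
    refine ⟨hy, ?_⟩
    have := h.lift (p := fun a b => a ∈ (ξ ∘ e) ⁻¹' {(ξ ∘ e) x} ∧
      b ∈ (ξ ∘ e) ⁻¹' {(ξ ∘ e) x} ∧ (a < b ∨ b < a)) e.symm fun a b hab =>
      ⟨by simpa using hab.1, by simpa using hab.2.1,
        hab.2.2.imp e.symm.lt_iff_lt.2 e.symm.lt_iff_lt.2⟩
    simpa [Function.onFun] using this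

theorem alpha_comp_orderIso {P' : Type*} [PartialOrder P'] (e : P' ≃o P) (ξ : P →o R) (x : P') :
    alpha (ξ.comp (e : P' →o P)) x = alpha ξ (e x) := by
  have hG : gxi (ξ.comp (e : P' →o P)) x = e ⁻¹' gxi ξ (e x) := gxi_comp_orderIso e ξ x
  apply EV.ext
  · rfl
  · simp only [alpha, hG]
    ext r
    constructor
    · rintro ⟨y, ⟨⟨a, ha, hya⟩, hn⟩, rfl⟩
      exact ⟨e y, ⟨⟨e a, ha, e.le_iff_le.2 hya⟩, hn⟩, rfl⟩
    · rintro ⟨y, ⟨⟨a, ha, hya⟩, hn⟩, rfl⟩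
      exact ⟨e.symm y, ⟨⟨e.symm a, by simpa using ha, e.symm.le_iff_le.2 hya⟩,
        by simpa using hn⟩, by simp⟩
  · simp only [alpha, hG]
    ext r
    constructor
    · rintro ⟨y, ⟨⟨a, ha, hya⟩, hn⟩, rfl⟩
      exact ⟨e y, ⟨⟨e a, ha, e.le_iff_le.2 hya⟩, hn⟩, rfl⟩
    · rintro ⟨y, ⟨⟨a, ha, hya⟩, hn⟩, rfl⟩
      exact ⟨e.symm y, ⟨⟨e.symm a, by simpa using ha, e.symm.le_iff_le.2 hya⟩,
        by simpa using hn⟩, by simp⟩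

end Alpha

/-- A map sending distinct strict comparabilities `x < y` to distinct pairs. -/
def EdgeInjective {R : Type*} [PartialOrder R] {S : Type*} (f : R → S) : Prop :=
  ∀ x y x' y', x < y → x' < y' → f x = f x' → f y = f y' → x = x' ∧ y = y'

/-! ### From an edge-injective map and an injection to a strong I-scheme. -/

section Construction

variable {R : Type u} [PartialOrder R] {P : Type w} [PartialOrder P]

section Fun

variable {S : Type v}

open Classical in
/-- The map applying `h` where the component of the fibre is a component of the whole poset, and
`f` elsewhere. -/
noncomputable def glueFun (f h : R → S) (ξ : P →o R) (x : P) : S :=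
  if openDown (gxi ξ x) = ∅ ∧ openUp (gxi ξ x) = ∅ then h (ξ x) else f (ξ x)

theorem glueFun_of_nonempty (f h : R → S) {ξ : P →o R} {x : P}
    (hx : (openDown (gxi ξ x)).Nonempty ∨ (openUp (gxi ξ x)).Nonempty) :
    glueFun f h ξ x = f (ξ x) := by
  refine if_neg fun hh => ?_
  rcases hx with hx | hx
  · exact hx.ne_empty hh.1
  · exact hx.ne_empty hh.2

theorem glueFun_lower (f h : R → S) {ξ : P →o R} {x y : P} (hxy : x < y) (hξ : ξ x ≠ ξ y) :
    glueFun f h ξ x = f (ξ x) :=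
  glueFun_of_nonempty f h (Or.inr ⟨y, mem_openUp_gxi hxy hξ⟩)

theorem glueFun_upper (f h : R → S) {ξ : P →o R} {x y : P} (hxy : x < y) (hξ : ξ x ≠ ξ y) :
    glueFun f h ξ y = f (ξ y) :=
  glueFun_of_nonempty f h (Or.inl ⟨x, mem_openDown_gxi hxy hξ⟩)

theorem glueFun_eq (f h : R → S) {ξ : P →o R} {x y : P} (hxy : x < y) (hξ : ξ x = ξ y) :
    glueFun f h ξ x = glueFun f h ξ y := by
  simp only [glueFun, gxi_eq_of_comparable (Or.inl hxy) hξ, hξ]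

end Fun

variable {S : Type v} [PartialOrder S]

theorem glueFun_lt {f : R → S} (hf : StrictMono f) (h : R → S) {ξ : P →o R} {x y : P}
    (hxy : x < y) (hξ : ξ x ≠ ξ y) : glueFun f h ξ x < glueFun f h ξ y := by
  rw [glueFun_lower f h hxy hξ, glueFun_upper f h hxy hξ]
  exact hf (lt_of_le_of_ne (ξ.monotone hxy.le) hξ)

/-- `glueFun` as an order homomorphism. -/
noncomputable def glue (f h : R → S) (hf : StrictMono f) (ξ : P →o R) : P →o S where
  toFun := glueFun f h ξ
  monotone' x y hxy := by
    rcases hxy.eq_or_lt with rfl | hlt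
    · exact le_rfl
    · by_cases hξ : ξ x = ξ y
      · exact (glueFun_eq f h hlt hξ).le
      · exact (glueFun_lt hf h hlt hξ).le

variable {f h : R → S} (hf : StrictMono f)

/-- As `f` is strict, gluing identifies exactly those comparable pairs that `ξ` identifies. -/
theorem gxi_glue (ξ : P →o R) (x : P) : gxi (glue f h hf ξ) x = gxi ξ x := by
  apply Set.Subset.antisymm
  · refine gxi_subset_of_comparable (fun a b hab he => ?_) x
    by_contra hξ
    exact (glueFun_lt hf h hab hξ).ne he
  · exact gxi_subset_of_comparable (fun a b hab he => glueFun_eq f h hab he) x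

theorem alpha_glue_dn (ξ : P →o R) (x : P) :
    (alpha (glue f h hf ξ) x).dn = f '' (alpha ξ x).dn := by
  simp only [alpha, gxi_glue, Set.image_image]
  refine Set.image_congr fun y hy => ?_
  obtain ⟨a, -, hya, hlt⟩ := exists_of_mem_openDown_gxi hy
  exact glueFun_lower f h hya hlt.ne

theorem alpha_glue_up (ξ : P →o R) (x : P) :
    (alpha (glue f h hf ξ) x).up = f '' (alpha ξ x).up := by
  simp only [alpha, gxi_glue, Set.image_image]
  refine Set.image_congr fun y hy => ?_
  obtain ⟨a, -, hya, hlt⟩ := exists_of_mem_openUp_gxi hy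
  exact glueFun_upper f h hya hlt.ne

-- The choice between `f` and `h` can be read off `alpha ξ x`; hence `alpha` of the glued map is a
-- function of `alpha ξ x` alone.
open Classical in
theorem alpha_glue_pt (ξ : P →o R) (x : P) :
    (alpha (glue f h hf ξ) x).pt =
      if (alpha ξ x).dn = ∅ ∧ (alpha ξ x).up = ∅ then h (alpha ξ x).pt else f (alpha ξ x).pt := by
  simp only [alpha, Set.image_eq_empty]
  rfl

theorem alpha_glue_eq {P' : Type*} [PartialOrder P'] {ξ : P →o R} {ζ : P' →o R} {x : P} {y : P'}
    (he : alpha ξ x = alpha ζ y) : alpha (glue f h hf ξ) x = alpha (glue f h hf ζ) y := by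
  apply EV.ext
  · rw [alpha_glue_pt, alpha_glue_pt, he]
  · rw [alpha_glue_dn, alpha_glue_dn, he]
  · rw [alpha_glue_up, alpha_glue_up, he]

theorem alpha_glue_ltPlus {P' : Type*} [PartialOrder P'] {ξ : P →o R} {ζ : P' →o R} {x : P}
    {y : P'} (hlt : (alpha ξ x).LtPlus (alpha ζ y)) :
    (alpha (glue f h hf ξ) x).LtPlus (alpha (glue f h hf ζ) y) := by
  obtain ⟨h₁, h₂⟩ := hlt
  constructor
  -- Points related by `<₊` have a nonempty `up` or `dn`, so only `f` acts on them.
  · rw [alpha_glue_dn, alpha_glue_pt, if_neg fun hh => (hh.2 ▸ h₂ : _ ∈ (∅ : Set R))]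
    exact ⟨_, h₁, rfl⟩
  · rw [alpha_glue_up, alpha_glue_pt, if_neg fun hh => (hh.1 ▸ h₁ : _ ∈ (∅ : Set R))]
    exact ⟨_, h₂, rfl⟩

theorem glue_injective (hinj : EdgeInjective f) (hh : Function.Injective h) :
    Function.Injective (glue f h hf : (P →o R) → (P →o S)) := by
  intro ξ ζ he
  have hG : ∀ x, gxi ξ x = gxi ζ x := fun x => by
    rw [← gxi_glue (h := h) hf ξ, ← gxi_glue (h := h) hf ζ, he]
  have hv : ∀ x, glueFun f h ξ x = glueFun f h ζ x := fun x => DFunLike.congr_fun he x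
  -- Edge injectivity recovers values only at both ends of a non-collapsed edge at once.
  have key : ∀ a b x, a < b → ξ a ≠ ξ b → ζ a ≠ ζ b → x ∈ ({a, b} : Set P) → ξ x = ζ x := by
    intro a b x hab hξ hζ hx
    have h₁ := hv a
    have h₂ := hv b
    rw [glueFun_lower f h hab hξ, glueFun_lower f h hab hζ] at h₁
    rw [glueFun_upper f h hab hξ, glueFun_upper f h hab hζ] at h₂
    obtain ⟨h₃, h₄⟩ := hinj _ _ _ _ (lt_of_le_of_ne (ξ.monotone hab.le) hξ)
      (lt_of_le_of_ne (ζ.monotone hab.le) hζ) h₁ h₂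
    rcases hx with rfl | rfl
    · exact h₃
    · exact h₄
  have hne : ∀ a b, a < b → ξ a ≠ ξ b → ζ a ≠ ζ b := by
    intro a b hab hξ hζ
    have := glueFun_lt hf h hab hξ
    rw [hv, hv, glueFun_eq f h hab hζ] at this
    exact lt_irrefl _ this
  ext x
  by_cases hd : (openDown (gxi ξ x)).Nonempty
  · obtain ⟨y, hy⟩ := hd
    obtain ⟨a, ha, hya, hlt⟩ := exists_of_mem_openDown_gxi hy
    have h₁ : ξ a = ξ x := ha.1
    have h₂ : ζ a = ζ x := (hG x ▸ ha : a ∈ gxi ζ x).1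
    rw [← h₁, ← h₂]
    exact key y a a hya hlt.ne (hne _ _ hya hlt.ne) (Or.inr rfl)
  by_cases hu : (openUp (gxi ξ x)).Nonempty
  · obtain ⟨y, hy⟩ := hu
    obtain ⟨a, ha, hya, hlt⟩ := exists_of_mem_openUp_gxi hy
    have h₁ : ξ a = ξ x := ha.1
    have h₂ : ζ a = ζ x := (hG x ▸ ha : a ∈ gxi ζ x).1
    rw [← h₁, ← h₂]
    exact key a y a hya hlt.ne (hne _ _ hya hlt.ne) (Or.inl rfl)
  -- No edge leaves the fibre component, so both maps are given by the injective `h` here.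
  rw [Set.not_nonempty_iff_eq_empty] at hd hu
  have := hv x
  simp only [glueFun, ← hG x, hd, hu, and_self, if_true] at this
  exact hh this

end Construction

theorem strongILe_of_edgeInjective (𝔓r : Set FinPoset.{w}) {R : Type u} [PartialOrder R]
    {S : Type v} [PartialOrder S] {f h : R → S} (hf : StrictMono f) (hinj : EdgeInjective f)
    (hh : Function.Injective h) : StrongILe 𝔓r R S := by
  refine ⟨fun P _ => glue f h hf, fun P _ => glue_injective hf hinj hh, ?_⟩
  intro P _ P' _ ξ ζ x y
  exact ⟨fun hle => hle.imp (alpha_glue_ltPlus hf) (alpha_glue_eq hf), alpha_glue_ltPlus hf⟩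

/-! ### From a strong I-scheme to an edge-injective map and an injection. -/

section Extraction

/-- Since `alpha` is invariant under isomorphism, the scheme can be transported to all finite
posets, so that concrete test posets may be used. -/
theorem IsRepSystem.strongILe_univ {𝔓r : Set FinPoset.{w}} (h𝔓r : IsRepSystem 𝔓r)
    {R : Type u} [PartialOrder R] {S : Type v} [PartialOrder S] (h : StrongILe 𝔓r R S) :
    StrongILe (Set.univ : Set FinPoset.{w}) R S := by
  obtain ⟨ρ, hs, hI⟩ := h
  have hex : ∀ P : FinPoset.{w}, ∃ P' : FinPoset.{w}, P' ∈ 𝔓r ∧ Nonempty (P ≃o P') :=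
    fun P => (h𝔓r P).exists
  choose T hT he using hex
  let e : ∀ P : FinPoset.{w}, P ≃o T P := fun P => (he P).some
  have hα : ∀ (P : FinPoset.{w}) (ξ : P →o R) (x : P),
      alpha ξ x = alpha (ξ.comp ((e P).symm : T P →o P)) (e P x) := fun P ξ x => by
    rw [alpha_comp_orderIso, OrderIso.symm_apply_apply]
  refine ⟨fun P _ ξ => (ρ (T P) (hT P) (ξ.comp ((e P).symm : T P →o P))).comp (e P : P →o T P),
    ?_, ?_⟩
  · intro P _ ξ ζ hξζ
    have h₁ : ρ (T P) (hT P) (ξ.comp ((e P).symm : T P →o P)) =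
        ρ (T P) (hT P) (ζ.comp ((e P).symm : T P →o P)) := by
      ext z
      have := DFunLike.congr_fun hξζ ((e P).symm z)
      simpa using this
    have h₂ := hs _ _ h₁
    ext z
    have := DFunLike.congr_fun h₂ (e P z)
    simpa using this
  · intro P _ P' _ ξ ζ x y
    have h₁ := alpha_comp_orderIso (e P) (ρ (T P) (hT P) (ξ.comp ((e P).symm : T P →o P))) x
    have h₂ := alpha_comp_orderIso (e P') (ρ (T P') (hT P') (ζ.comp ((e P').symm : T P' →o P'))) y
    rw [hα P ξ x, hα P' ζ y, h₁, h₂]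
    exact hI (T P) (hT P) (T P') (hT P') _ _ (e P x) (e P' y)

variable {R : Type u} [PartialOrder R] {S : Type v} [PartialOrder S]

/-- The two-element chain. -/
def chainPoset : FinPoset.{w} := ⟨ULift.{w} Bool⟩

/-- The homomorphism from the two-element chain with values `x < y`. -/
def chainHom {x y : R} (h : x < y) : chainPoset.{w} →o R where
  toFun b := bif b.down then y else x
  monotone' := by
    rintro ⟨a⟩ ⟨b⟩ hab
    have hab' : a ≤ b := hab
    revert hab'
    cases a <;> cases b <;> simp [h.le]

/-- The least element of the two-element chain. -/
def chainBot : chainPoset.{w} := ⟨false⟩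

/-- The greatest element of the two-element chain. -/
def chainTop : chainPoset.{w} := ⟨true⟩

theorem chain_cases (b : chainPoset.{w}) : b = chainBot ∨ b = chainTop := by
  rcases b with ⟨_ | _⟩
  · exact Or.inl rfl
  · exact Or.inr rfl

theorem chainBot_lt_chainTop : chainBot.{w} < chainTop.{w} :=
  show (ULift.up false : ULift.{w} Bool) < ULift.up true from Bool.false_lt_true

theorem alpha_chainHom_chainTop {x y : R} (h : x < y) :
    (alpha (chainHom.{u, w} h) chainTop).pt = y ∧ (alpha (chainHom.{u, w} h) chainTop).dn = {x} ∧
      (alpha (chainHom.{u, w} h) chainTop).up = ∅ := by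
  have := (alpha_eq_iff_of_strict_at (ξ := chainHom.{u, w} h) (x := chainTop) ?_ ?_ _).1 rfl
  · obtain ⟨-, hd, hu⟩ := this
    refine ⟨rfl, hd.symm.trans ?_, hu.symm.trans ?_⟩
    · have : Set.Iio chainTop.{w} = {chainBot} := by
        ext b
        rcases chain_cases b with rfl | rfl
        · simp [chainBot_lt_chainTop]
        · simp [chainBot_lt_chainTop.ne']
      rw [this, Set.image_singleton]
      rfl
    · rw [Set.image_eq_empty, Set.eq_empty_iff_forall_notMem]
      intro b hb
      rcases chain_cases b with rfl | rfl
      · exact lt_asymm chainBot_lt_chainTop hb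
      · exact lt_irrefl chainTop hb
  · intro b hb
    rcases chain_cases b with rfl | rfl
    · exact h.ne
    · exact absurd hb (lt_irrefl _)
  · intro b hb
    rcases chain_cases b with rfl | rfl
    · exact h.ne
    · exact absurd hb (lt_irrefl _)

theorem alpha_chainHom_chainBot {x y : R} (h : x < y) :
    (alpha (chainHom.{u, w} h) chainBot).pt = x ∧ (alpha (chainHom.{u, w} h) chainBot).dn = ∅ ∧
      (alpha (chainHom.{u, w} h) chainBot).up = {y} := by
  have := (alpha_eq_iff_of_strict_at (ξ := chainHom.{u, w} h) (x := chainBot) ?_ ?_ _).1 rfl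
  · obtain ⟨-, hd, hu⟩ := this
    refine ⟨rfl, hd.symm.trans ?_, hu.symm.trans ?_⟩
    · rw [Set.image_eq_empty, Set.eq_empty_iff_forall_notMem]
      intro b hb
      rcases chain_cases b with rfl | rfl
      · exact lt_irrefl chainBot hb
      · exact lt_asymm chainBot_lt_chainTop hb
    · have : Set.Ioi chainBot.{w} = {chainTop} := by
        ext b
        rcases chain_cases b with rfl | rfl
        · simp [chainBot_lt_chainTop.ne]
        · simp [chainBot_lt_chainTop]
      rw [this, Set.image_singleton]
      rfl
  · intro b hb
    rcases chain_cases b with rfl | rfl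
    · exact absurd hb (lt_irrefl _)
    · exact h.ne'
  · intro b hb
    rcases chain_cases b with rfl | rfl
    · exact absurd hb (lt_irrefl _)
    · exact h.ne'

/-! ### The fence as a test poset. -/

/-- The points of the fence `c < b > a < d`. -/
inductive Fence : Type w
  | a | b | c | d

namespace Fence

/-- The order of the fence `c < b > a < d`. -/
def Le (x y : Fence.{w}) : Prop :=
  x = y ∨ (x = a ∧ y = b) ∨ (x = a ∧ y = d) ∨ (x = c ∧ y = b)

instance : PartialOrder Fence.{w} where
  le := Le
  le_refl _ := Or.inl rfl
  le_trans x y z := by cases x <;> cases y <;> cases z <;> simp [Le]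
  le_antisymm x y := by cases x <;> cases y <;> simp [Le]

theorem le_def (x y : Fence.{w}) :
    x ≤ y ↔ x = y ∨ (x = a ∧ y = b) ∨ (x = a ∧ y = d) ∨ (x = c ∧ y = b) := Iff.rfl

theorem lt_def (x y : Fence.{w}) :
    x < y ↔ (x = a ∧ y = b) ∨ (x = a ∧ y = d) ∨ (x = c ∧ y = b) := by
  rw [lt_iff_le_and_ne, le_def]
  cases x <;> cases y <;> simp

instance : Finite Fence.{w} :=
  Finite.of_injective (fun x : Fence.{w} => (x.casesOn 0 1 2 3 : Fin 4)) (by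
    intro x y
    cases x <;> cases y <;> simp)

instance : Nonempty Fence.{w} := ⟨a⟩

end Fence

/-- The fence `c < b > a < d`. -/
def fencePoset : FinPoset.{w} := ⟨Fence.{w}⟩

/-- The homomorphism from the fence with given values. -/
def fenceHom {xa xb xc xd : R} (hab : xa ≤ xb) (had : xa ≤ xd) (hcb : xc ≤ xb) :
    Fence.{w} →o R where
  toFun z := z.casesOn xa xb xc xd
  monotone' x y hxy := by
    rw [Fence.le_def] at hxy
    rcases hxy with rfl | ⟨rfl, rfl⟩ | ⟨rfl, rfl⟩ | ⟨rfl, rfl⟩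
    · exact le_rfl
    · exact hab
    · exact had
    · exact hcb

theorem Fence.alpha_d {ξ : Fence.{w} →o R} (h : ξ .a < ξ .d) :
    alpha ξ .d = alpha (chainHom.{u, w} h) chainTop := by
  obtain ⟨h₁, h₂, h₃⟩ := alpha_chainHom_chainTop.{u, w} h
  rw [alpha_eq_iff_of_strict_at, h₁, h₂, h₃]
  · refine ⟨rfl, ?_, ?_⟩
    · ext r
      simp [Fence.lt_def, eq_comm]
    · ext r
      simp [Fence.lt_def]
  · intro y hy
    rw [Fence.lt_def] at hy
    rcases hy with ⟨rfl, hh⟩ | ⟨rfl, hh⟩ | ⟨rfl, hh⟩ <;> simp_all [h.ne]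
  · intro y hy
    rw [Fence.lt_def] at hy
    simp at hy

theorem Fence.alpha_c {ξ : Fence.{w} →o R} (h : ξ .c < ξ .b) :
    alpha ξ .c = alpha (chainHom.{u, w} h) chainBot := by
  obtain ⟨h₁, h₂, h₃⟩ := alpha_chainHom_chainBot.{u, w} h
  rw [alpha_eq_iff_of_strict_at, h₁, h₂, h₃]
  · refine ⟨rfl, ?_, ?_⟩
    · ext r
      simp [Fence.lt_def]
    · ext r
      simp [Fence.lt_def, eq_comm]
  · intro y hy
    rw [Fence.lt_def] at hy
    simp at hy
  · intro y hy
    rw [Fence.lt_def] at hy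
    rcases hy with ⟨hh, rfl⟩ | ⟨hh, rfl⟩ | ⟨hh, rfl⟩ <;> simp_all [h.ne']

theorem Fence.alpha_b {ξ : Fence.{w} →o R} (h : ξ .a < ξ .b) (hc : ξ .c = ξ .a) :
    alpha ξ .b = alpha (chainHom.{u, w} h) chainTop := by
  obtain ⟨h₁, h₂, h₃⟩ := alpha_chainHom_chainTop.{u, w} h
  rw [alpha_eq_iff_of_strict_at, h₁, h₂, h₃]
  · refine ⟨rfl, ?_, ?_⟩
    · ext r
      simp [Fence.lt_def, or_and_right, exists_or, hc, eq_comm]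
    · ext r
      simp [Fence.lt_def]
  · intro y hy
    rw [Fence.lt_def] at hy
    rcases hy with ⟨rfl, hh⟩ | ⟨rfl, hh⟩ | ⟨rfl, hh⟩
    · exact h.ne
    · exact h.ne
    · exact hc ▸ h.ne
  · intro y hy
    rw [Fence.lt_def] at hy
    simp at hy

theorem Fence.alpha_a {ξ : Fence.{w} →o R} (h : ξ .a < ξ .b) (hd : ξ .d = ξ .b) :
    alpha ξ .a = alpha (chainHom.{u, w} h) chainBot := by
  obtain ⟨h₁, h₂, h₃⟩ := alpha_chainHom_chainBot.{u, w} h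
  rw [alpha_eq_iff_of_strict_at, h₁, h₂, h₃]
  · refine ⟨rfl, ?_, ?_⟩
    · ext r
      simp [Fence.lt_def]
    · ext r
      simp [Fence.lt_def, or_and_right, exists_or, hd, eq_comm]
  · intro y hy
    rw [Fence.lt_def] at hy
    simp at hy
  · intro y hy
    rw [Fence.lt_def] at hy
    rcases hy with ⟨hh, rfl⟩ | ⟨hh, rfl⟩ | ⟨hh, rfl⟩
    · exact h.ne'
    · exact hd ▸ h.ne'
    · exact h.ne'

/-! ### Values of an I-scheme on edges. -/

variable {ρ : HomScheme (Set.univ : Set FinPoset.{w}) R S}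

theorem HomScheme.IsIScheme.alpha_eq (hρ : ρ.IsIScheme) {P P' : FinPoset.{w}} {ξ : P →o R}
    {ζ : P' →o R} {x : P} {y : P'} (h : alpha ξ x = alpha ζ y) :
    alpha (ρ P trivial ξ) x = alpha (ρ P' trivial ζ) y :=
  ((hρ P trivial P' trivial ξ ζ x y).1 (Or.inr h)).antisymm
    ((hρ P' trivial P trivial ζ ξ y x).1 (Or.inr h.symm))

theorem HomScheme.IsIScheme.map_lt (hρ : ρ.IsIScheme) {P : FinPoset.{w}} {ξ : P →o R} {x y : P}
    (h : x < y) (hξ : ξ x ≠ ξ y) : ρ P trivial ξ x < ρ P trivial ξ y :=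
  ((hρ P trivial P trivial ξ ξ x y).2 (alpha_ltPlus h hξ)).pt_lt

/-- The image homomorphism has the same `dn` at `q` as at the top of the chain, and there only the
value at `chainBot` can occur. -/
theorem HomScheme.IsIScheme.map_lower (hρ : ρ.IsIScheme) {P : FinPoset.{w}} {ξ : P →o R}
    {p q : P} {x y : R} (hxy : x < y) (hα : alpha ξ q = alpha (chainHom.{u, w} hxy) chainTop)
    (hpq : p < q) (hξ : ξ p ≠ ξ q) :
    ρ P trivial ξ p = ρ chainPoset trivial (chainHom hxy) chainBot := by
  have h₁ : ρ P trivial ξ p ∈ (alpha (ρ P trivial ξ) q).dn :=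
    ⟨p, mem_openDown_gxi hpq (hρ.map_lt hpq hξ).ne, rfl⟩
  rw [hρ.alpha_eq hα] at h₁
  obtain ⟨z, hz, hzp⟩ := h₁
  rcases chain_cases z with rfl | rfl
  · exact hzp.symm
  · exact absurd (self_mem_gxi _ _) hz.2

theorem HomScheme.IsIScheme.map_upper (hρ : ρ.IsIScheme) {P : FinPoset.{w}} {ξ : P →o R}
    {p q : P} {x y : R} (hxy : x < y) (hα : alpha ξ p = alpha (chainHom.{u, w} hxy) chainBot)
    (hpq : p < q) (hξ : ξ p ≠ ξ q) :
    ρ P trivial ξ q = ρ chainPoset trivial (chainHom hxy) chainTop := by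
  have h₁ : ρ P trivial ξ q ∈ (alpha (ρ P trivial ξ) p).up :=
    ⟨q, mem_openUp_gxi hpq (hρ.map_lt hpq hξ).ne, rfl⟩
  rw [hρ.alpha_eq hα] at h₁
  obtain ⟨z, hz, hzp⟩ := h₁
  rcases chain_cases z with rfl | rfl
  · exact absurd (self_mem_gxi _ _) hz.2
  · exact hzp.symm

theorem Fence.a_lt_b : (Fence.a : Fence.{w}) < .b := by simp [Fence.lt_def]
theorem Fence.a_lt_d : (Fence.a : Fence.{w}) < .d := by simp [Fence.lt_def]
theorem Fence.c_lt_b : (Fence.c : Fence.{w}) < .b := by simp [Fence.lt_def]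

/-- The point `a` lies below both `b` and `d`, which look like tops of the chains `x < y` and `x <
y'`; both chains therefore prescribe the value at `a`. -/
theorem HomScheme.IsIScheme.chainBot_eq (hρ : ρ.IsIScheme) {x y y' : R} (h : x < y) (h' : x < y') :
    ρ chainPoset trivial (chainHom h) chainBot = ρ chainPoset trivial (chainHom h') chainBot := by
  let ξ : Fence.{w} →o R := fenceHom h.le h'.le h.le
  exact (hρ.map_lower (P := fencePoset) (ξ := ξ) h (Fence.alpha_b (ξ := ξ) h rfl)
    Fence.a_lt_b h.ne).symm.trans
    (hρ.map_lower (P := fencePoset) (ξ := ξ) h' (Fence.alpha_d (ξ := ξ) h') Fence.a_lt_d h'.ne)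

theorem HomScheme.IsIScheme.chainTop_eq (hρ : ρ.IsIScheme) {x y y' : R} (h : y < x) (h' : y' < x) :
    ρ chainPoset trivial (chainHom h) chainTop = ρ chainPoset trivial (chainHom h') chainTop := by
  let ξ : Fence.{w} →o R := fenceHom h.le h.le h'.le
  exact (hρ.map_upper (P := fencePoset) (ξ := ξ) h (Fence.alpha_a (ξ := ξ) h rfl)
    Fence.a_lt_b h.ne).symm.trans
    (hρ.map_upper (P := fencePoset) (ξ := ξ) h' (Fence.alpha_c (ξ := ξ) h') Fence.c_lt_b h'.ne)

theorem HomScheme.IsIScheme.chainTop_eq_chainBot (hρ : ρ.IsIScheme) {x y y' : R} (h : y < x)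
    (h' : x < y') :
    ρ chainPoset trivial (chainHom h) chainTop = ρ chainPoset trivial (chainHom h') chainBot := by
  -- Here `a` and `b` both go to `x` and share a fibre component; `c` fixes the new value at `b`,
  -- `d` the one at `a`.
  let ξ : Fence.{w} →o R := fenceHom le_rfl h'.le h.le
  have h₁ := hρ.map_upper (P := fencePoset) (ξ := ξ) h (Fence.alpha_c (ξ := ξ) h)
    Fence.c_lt_b h.ne
  have h₂ := hρ.map_lower (P := fencePoset) (ξ := ξ) h' (Fence.alpha_d (ξ := ξ) h')
    Fence.a_lt_d h'.ne
  have h₃ : alpha ξ .a = alpha ξ .b := alpha_eq_of_comparable (Or.inl Fence.a_lt_b) rfl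
  have h₄ := hρ.alpha_eq (P := fencePoset) (P' := fencePoset) h₃
  exact h₁.symm.trans ((congrArg EV.pt h₄).symm.trans h₂)

theorem exists_strictMono_edgeInjective [Nonempty S]
    (h : StrongILe (Set.univ : Set FinPoset.{w}) R S) :
    ∃ f : R → S, StrictMono f ∧ EdgeInjective f := by
  classical
  obtain ⟨ρ, hs, hρ⟩ := h
  -- The choice of edge at `x` is immaterial by the three preceding lemmas; isolated points lie on
  -- no edge, so any value serves.
  let f : R → S := fun x =>
    if hx : ∃ y, x < y then ρ chainPoset trivial (chainHom hx.choose_spec) chainBot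
    else if hx : ∃ y, y < x then ρ chainPoset trivial (chainHom hx.choose_spec) chainTop
    else Classical.arbitrary S
  have hbot : ∀ {x y : R} (h : x < y), ρ chainPoset trivial (chainHom h) chainBot = f x := by
    intro x y h
    have hx : ∃ y, x < y := ⟨y, h⟩
    simp only [f, dif_pos hx]
    exact hρ.chainBot_eq _ _
  have htop : ∀ {x y : R} (h : x < y), ρ chainPoset trivial (chainHom h) chainTop = f y := by
    intro x y h
    by_cases hy : ∃ z, y < z
    · simp only [f, dif_pos hy]
      exact hρ.chainTop_eq_chainBot _ _
    · have hy' : ∃ z, z < y := ⟨x, h⟩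
      simp only [f, dif_neg hy, dif_pos hy']
      exact hρ.chainTop_eq _ _
  refine ⟨f, fun x y h => ?_, fun x y x' y' h h' hx hy => ?_⟩
  · rw [← hbot h, ← htop h]
    exact hρ.map_lt chainBot_lt_chainTop h.ne
  · rw [← hbot h, ← hbot h'] at hx
    rw [← htop h, ← htop h'] at hy
    -- Edges of `R` are strict homomorphisms from the chain, where `ρ` is one-to-one.
    have he : (chainHom h : chainPoset.{w} →o R) = chainHom h' := by
      refine hs _ trivial (OrderHom.ext _ _ (funext fun b => ?_))
      rcases chain_cases b with rfl | rfl
      · exact hx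
      · exact hy
    exact ⟨DFunLike.congr_fun he chainBot, DFunLike.congr_fun he chainTop⟩

theorem exists_injective (h : StrongILe (Set.univ : Set FinPoset.{w}) R S) :
    ∃ f : R → S, Function.Injective f := by
  obtain ⟨ρ, hs, -⟩ := h
  refine ⟨fun x => ρ ⟨PUnit.{w + 1}⟩ trivial (OrderHom.const _ x) PUnit.unit, fun x y hxy => ?_⟩
  have h₁ := hs _ trivial (OrderHom.ext _ _ (funext fun _ => hxy))
  exact DFunLike.congr_fun h₁ PUnit.unit

end Extraction

/-! ### Cancelling `Q` by iteration along edges. -/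

section Cancellation

variable {Q R S : Type*}

theorem exists_injective_of_sum [Finite Q] [Finite R] [Finite S] {f : Q ⊕ R → Q ⊕ S}
    (hf : Function.Injective f) : ∃ g : R → S, Function.Injective g := by
  have := Nat.card_le_card_of_injective f hf
  rw [Nat.card_sum, Nat.card_sum] at this
  cases nonempty_fintype R
  cases nonempty_fintype S
  obtain ⟨g⟩ := Function.Embedding.nonempty_of_card_le (α := R) (β := S) (by
    rw [← Nat.card_eq_fintype_card, ← Nat.card_eq_fintype_card]
    omega)
  exact ⟨g, g.injective⟩

/-- One step of the iteration of `f` that stops upon leaving `Q`. -/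
def sumStep (f : Q ⊕ R → Q ⊕ S) : Q ⊕ S → Q ⊕ S := Sum.elim (f ∘ Sum.inl) Sum.inr

/-- The iteration of `f`, starting in `R`, that stops upon leaving `Q`. -/
def sumIter (f : Q ⊕ R → Q ⊕ S) (n : ℕ) (x : R) : Q ⊕ S := (sumStep f)^[n] (f (Sum.inr x))

theorem sumIter_succ (f : Q ⊕ R → Q ⊕ S) (n : ℕ) (x : R) :
    sumIter f (n + 1) x = sumStep f (sumIter f n x) :=
  Function.iterate_succ_apply' _ _ _

theorem sumIter_of_isRight {f : Q ⊕ R → Q ⊕ S} {n m : ℕ} (hnm : n ≤ m) {x : R}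
    (h : (sumIter f n x).isRight) : sumIter f m x = sumIter f n x := by
  induction m, hnm using Nat.le_induction with
  | base => rfl
  | succ m _ ih =>
    obtain ⟨s, hs⟩ := Sum.isRight_iff.1 h
    rw [sumIter_succ, ih, hs]
    rfl

variable [PartialOrder Q] [PartialOrder R] [PartialOrder S] {f : Q ⊕ R → Q ⊕ S}

theorem sumStep_strictMono (hf : StrictMono f) : StrictMono (sumStep f) := by
  rintro (a | a) (b | b) hab
  · exact hf (Sum.inl_lt_inl_iff.2 (Sum.inl_lt_inl_iff.1 hab))
  · exact absurd hab Sum.not_inl_lt_inr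
  · exact absurd hab Sum.not_inr_lt_inl
  · exact hab

theorem sumIter_strictMono (hf : StrictMono f) (n : ℕ) : StrictMono (sumIter f n) := fun _ _ h =>
  (sumStep_strictMono hf).iterate n (hf (Sum.inr_lt_inr_iff.2 h))

theorem isLeft_of_lt {a b : Q ⊕ S} (h : a < b) : a.isLeft = b.isLeft := by
  rcases a with a | a <;> rcases b with b | b
  · rfl
  · exact absurd h Sum.not_inl_lt_inr
  · exact absurd h Sum.not_inr_lt_inl
  · rfl

/-- Before the iteration stops, no comparability is reached twice. -/
theorem sumIter_edge_injective (hf : StrictMono f) (hinj : EdgeInjective f) {x y x' y' : R}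
    (h : x < y) (h' : x' < y') (i j : ℕ) (hi : ∀ k < i, (sumIter f k x).isLeft)
    (hj : ∀ k < j, (sumIter f k x').isLeft) (hx : sumIter f i x = sumIter f j x')
    (hy : sumIter f i y = sumIter f j y') : i = j ∧ x = x' ∧ y = y' := by
  have pred : ∀ {x y : R} (_ : x < y) (k : ℕ), (sumIter f k x).isLeft →
      ∃ p q : Q, p < q ∧ sumIter f k x = .inl p ∧ sumIter f k y = .inl q ∧
        sumIter f (k + 1) x = f (.inl p) ∧ sumIter f (k + 1) y = f (.inl q) := by
    intro x y h k hk
    have hlt := sumIter_strictMono hf k h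
    have hk' := isLeft_of_lt hlt ▸ hk
    obtain ⟨p, hp⟩ := Sum.isLeft_iff.1 hk
    obtain ⟨q, hq⟩ := Sum.isLeft_iff.1 hk'
    rw [hp, hq] at hlt
    refine ⟨p, q, Sum.inl_lt_inl_iff.1 hlt, hp, hq, ?_, ?_⟩
    · rw [sumIter_succ, hp]
      rfl
    · rw [sumIter_succ, hq]
      rfl
  -- Both orbits are traced back simultaneously; an edge of `R` and an edge of `Q` never share an
  -- image under `f`, so the two starts coincide in time.
  induction i generalizing j with
  | zero =>
    cases j with
    | zero =>
      obtain ⟨h₁, h₂⟩ := hinj _ _ _ _ (Sum.inr_lt_inr_iff.2 h) (Sum.inr_lt_inr_iff.2 h') hx hy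
      exact ⟨rfl, Sum.inr_injective h₁, Sum.inr_injective h₂⟩
    | succ j =>
      obtain ⟨p, q, hpq, -, -, hp, hq⟩ := pred h' j (hj j j.lt_succ_self)
      rw [hp] at hx
      rw [hq] at hy
      have := (hinj _ _ _ _ (Sum.inr_lt_inr_iff.2 h) (Sum.inl_lt_inl_iff.2 hpq) hx hy).1
      exact absurd this Sum.inr_ne_inl
  | succ i ih =>
    obtain ⟨p, q, hpq, hp, hq, hp', hq'⟩ := pred h i (hi i i.lt_succ_self)
    rw [hp'] at hx
    rw [hq'] at hy
    cases j with
    | zero =>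
      have := (hinj _ _ _ _ (Sum.inl_lt_inl_iff.2 hpq) (Sum.inr_lt_inr_iff.2 h') hx hy).1
      exact absurd this Sum.inl_ne_inr
    | succ j =>
      obtain ⟨s, t, hst, hs, ht, hs', ht'⟩ := pred h' j (hj j j.lt_succ_self)
      rw [hs'] at hx
      rw [ht'] at hy
      obtain ⟨h₁, h₂⟩ := hinj _ _ _ _ (Sum.inl_lt_inl_iff.2 hpq) (Sum.inl_lt_inl_iff.2 hst) hx hy
      obtain ⟨h₃, h₄⟩ := ih j (fun k hk => hi k (hk.trans i.lt_succ_self))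
        (fun k hk => hj k (hk.trans j.lt_succ_self))
        (by rw [hp, hs, Sum.inl_injective h₁]) (by rw [hq, ht, Sum.inl_injective h₂])
      exact ⟨congrArg _ h₃, h₄⟩

theorem exists_sumIter_isRight [Finite Q] (hf : StrictMono f) (hinj : EdgeInjective f) {x y : R}
    (h : x < y) : ∃ n, (sumIter f n x).isRight := by
  by_contra! hn
  have hl : ∀ n, (sumIter f n x).isLeft := fun n => by simpa using hn n
  have hl' : ∀ n, (sumIter f n y).isLeft := fun n =>
    isLeft_of_lt (sumIter_strictMono hf n h) ▸ hl n
  -- An orbit trapped in `Q` would inject the natural numbers into `Q × Q`.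
  refine not_injective_infinite_finite
    (fun n : ℕ => ((sumIter f n x).getLeft (hl n), (sumIter f n y).getLeft (hl' n))) ?_
  intro i j hij
  simp only [Prod.mk.injEq] at hij
  refine (sumIter_edge_injective hf hinj h h i j (fun k _ => hl k) (fun k _ => hl k) ?_ ?_).1
  · rw [← Sum.inl_getLeft _ (hl i), hij.1, Sum.inl_getLeft]
  · rw [← Sum.inl_getLeft _ (hl' i), hij.2, Sum.inl_getLeft]

theorem exists_strictMono_edgeInjective_of_sum [Finite Q] [Finite R] [Nonempty S]
    (hf : StrictMono f) (hinj : EdgeInjective f) :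
    ∃ g : R → S, StrictMono g ∧ EdgeInjective g := by
  classical
  have hex : ∀ e : {e : R × R // e.1 < e.2}, ∃ n, (sumIter f n e.1.1).isRight := fun e =>
    exists_sumIter_isRight hf hinj e.2
  -- A common bound on the exit times makes the limit a map on points. A point still in `Q` at time
  -- `N` lies on no edge, so its value is arbitrary.
  obtain ⟨N, hN⟩ := Set.Finite.bddAbove (Set.finite_range fun e => Nat.find (hex e))
  have hNr : ∀ {x y : R} (h : x < y), sumIter f N x = sumIter f (Nat.find (hex ⟨(x, y), h⟩)) x ∧
      sumIter f N y = sumIter f (Nat.find (hex ⟨(x, y), h⟩)) y ∧ (sumIter f N x).isRight ∧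
      (sumIter f N y).isRight := by
    intro x y h
    have hle : Nat.find (hex ⟨(x, y), h⟩) ≤ N := hN ⟨⟨(x, y), h⟩, rfl⟩
    have hs : (sumIter f (Nat.find (hex ⟨(x, y), h⟩)) x).isRight := Nat.find_spec (hex ⟨(x, y), h⟩)
    have hs' : (sumIter f (Nat.find (hex ⟨(x, y), h⟩)) y).isRight := by
      rw [← Sum.not_isLeft] at hs ⊢
      rwa [← isLeft_of_lt (sumIter_strictMono hf _ h)]
    rw [sumIter_of_isRight hle hs, sumIter_of_isRight hle hs']
    exact ⟨rfl, rfl, hs, hs'⟩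
  let g : R → S := fun x => Sum.elim (fun _ => Classical.arbitrary S) id (sumIter f N x)
  have hg : ∀ {x : R}, (sumIter f N x).isRight → sumIter f N x = Sum.inr (g x) := by
    intro x hx
    obtain ⟨s, hs⟩ := Sum.isRight_iff.1 hx
    simp [g, hs]
  refine ⟨g, fun x y h => ?_, fun x y x' y' h h' hx hy => ?_⟩
  · obtain ⟨-, -, h₁, h₂⟩ := hNr h
    have := sumIter_strictMono hf N h
    rw [hg h₁, hg h₂] at this
    exact Sum.inr_lt_inr_iff.1 this
  · obtain ⟨h₁, h₂, h₃, h₄⟩ := hNr h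
    obtain ⟨h₁', h₂', h₃', h₄'⟩ := hNr h'
    -- The comparison takes place at the first exit times, before which every step is a genuine
    -- application of `f`.
    refine (sumIter_edge_injective hf hinj h h' _ _ (fun k hk => ?_) (fun k hk => ?_)
      (h₁.symm.trans (Eq.trans ?_ h₁')) (h₂.symm.trans (Eq.trans ?_ h₂'))).2
    · simpa using Nat.find_min _ hk
    · simpa using Nat.find_min _ hk
    · rw [hg h₃, hg h₃', hx]
    · rw [hg h₄, hg h₄', hy]

end Cancellation

end HomSchemes

/-- Cancellation of a direct summand for strong I-schemes. The direct sum of disjoint posets is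
the sum type with its disjoint-union order (no comparabilities between the summands). -/
theorem theorem4 (𝔓r : Set HomSchemes.FinPoset)
    (h𝔓r : HomSchemes.IsRepSystem 𝔓r)
    (Q : Type*) [PartialOrder Q] [Finite Q] [Nonempty Q]
    (R : Type*) [PartialOrder R] [Finite R] [Nonempty R]
    (S : Type*) [PartialOrder S] [Finite S] [Nonempty S]
    (h : HomSchemes.StrongILe 𝔓r (Q ⊕ R) (Q ⊕ S)) :
    HomSchemes.StrongILe 𝔓r R S := by
  have h' := h𝔓r.strongILe_univ h
  obtain ⟨f, hf, hinj⟩ := HomSchemes.exists_strictMono_edgeInjective h'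
  obtain ⟨k, hk⟩ := HomSchemes.exists_injective h'
  obtain ⟨g, hg, hginj⟩ := HomSchemes.exists_strictMono_edgeInjective_of_sum hf hinj
  obtain ⟨l, hl⟩ := HomSchemes.exists_injective_of_sum hk
  exact HomSchemes.strongILe_of_edgeInjective 𝔓r hg hginj hl
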